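/- Let $p$ be a prime number, let $\mathbb{Z}[\rho]=\mathbb{Z}[X]/(X^{p-1}+\cdots+X+1)$, with $\rho$ the class of $X$ (a primitive $p$-th root of one), and put $\eta=\rho-1$. Let $B=\mathbb{Z}[\rho]\langle x,y\rangle/(xy-\rho yx-1)$ be the quotient of the free $\mathbb{Z}[\rho]$-algebra on $x,y$ by the two-sided ideal generated by $xy-\rho yx-1$. The elements $s=x^p$ and $t=y^p$ are central in $B$; let $C$ be the center of $B$. Then $C=\mathbb{Z}[\rho][s,t]$ is a polynomial ring in $s$ and $t$ over $\mathbb{Z}[\rho]$. Put $\pi=1+(-1)^{p+1}st\eta^p\in C$, that is, $\pi=1+st\eta^p$ if $p$ is odd, and $\pi=1-st\eta^2=1-4st$ if $p=2$. Then $B/C$ is Azumaya precisely on the open set $D(\pi)\subset\operatorname{Spec} C$: for every prime ideal $P$ of $C$, the localization $B_P=C_P\otimes_C B$ is an Azumaya algebra over the local ring $C_P$ if and only if $\pi\notin P$; moreover $B[1/\pi]=C[1/\pi]\otimes_C B$ is an Azumaya algebra over $C[1/\pi]$. -/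

import Mathlib

open scoped TensorProduct

namespace CuriousAlgebra

/-- The ring `ℤ[ρ] = ℤ[X] / (Φ_p)`, which for a prime `p` is
`ℤ[X] / (X ^ (p - 1) + ⋯ + X + 1)`. -/
abbrev ZRho (p : ℕ) : Type := AdjoinRoot (Polynomial.cyclotomic p ℤ)

/-- The primitive `p`-th root of one `ρ`, the class of `X` in `ℤ[X] / (Φ_p)`. -/
noncomputable abbrev rho (p : ℕ) : ZRho p := AdjoinRoot.root (Polynomial.cyclotomic p ℤ)

/-- The element `η = ρ - 1`. -/
noncomputable abbrev eta (p : ℕ) : ZRho p := rho p - 1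

/-- The relation `x y = ρ y x + 1` on the free algebra `ℤ[ρ]⟨x, y⟩`; here `x` and `y` are the
generators with index `0` and `1`. -/
inductive Rel (p : ℕ) : FreeAlgebra (ZRho p) (Fin 2) → FreeAlgebra (ZRho p) (Fin 2) → Prop
  | comm : Rel p (FreeAlgebra.ι (ZRho p) 0 * FreeAlgebra.ι (ZRho p) 1)
      (rho p • (FreeAlgebra.ι (ZRho p) 1 * FreeAlgebra.ι (ZRho p) 0) + 1)

/-- The algebra `B = ℤ[ρ]⟨x, y⟩ / (x y - ρ y x - 1)`: the quotient of the free algebra by the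
two-sided ideal generated by `x y - ρ y x - 1`. -/
def B (p : ℕ) : Type := RingQuot (Rel p)

noncomputable instance (p : ℕ) : Ring (B p) := inferInstanceAs (Ring (RingQuot (Rel p)))

noncomputable instance (p : ℕ) : Algebra (ZRho p) (B p) :=
  inferInstanceAs (Algebra (ZRho p) (RingQuot (Rel p)))

/-- The quotient map `ℤ[ρ]⟨x, y⟩ → B`. -/
noncomputable def mk (p : ℕ) : FreeAlgebra (ZRho p) (Fin 2) →ₐ[ZRho p] B p :=
  RingQuot.mkAlgHom (ZRho p) (Rel p)

/-- The image of `x` in `B`. -/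
noncomputable def x (p : ℕ) : B p := mk p (FreeAlgebra.ι (ZRho p) 0)

/-- The image of `y` in `B`. -/
noncomputable def y (p : ℕ) : B p := mk p (FreeAlgebra.ι (ZRho p) 1)

/-- The center `C` of `B`. -/
abbrev C (p : ℕ) : Type := Subalgebra.center (ZRho p) (B p)

/-- `B` as an algebra over its center, by inclusion and multiplication in `B`. -/
noncomputable instance (p : ℕ) : Algebra (C p) (B p) where
  algebraMap := (Subalgebra.center (ZRho p) (B p)).val.toRingHom
  commutes' c b := ((Subalgebra.mem_center_iff.mp c.2) b).symm
  smul_def' _ _ := rfl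

theorem x_mul_y (p : ℕ) : x p * y p = rho p • (y p * x p) + 1 := by
  have h : mk p _ = mk p _ := RingQuot.mkAlgHom_rel (ZRho p) (Rel.comm (p := p))
  rwa [map_mul, map_add, map_smul, map_mul, map_one] at h

theorem geom_sum_rho (p : ℕ) (hp : p.Prime) : ∑ i ∈ Finset.range p, rho p ^ i = 0 := by
  have := Fact.mk hp
  have h : AdjoinRoot.mk (Polynomial.cyclotomic p ℤ) (∑ i ∈ Finset.range p, Polynomial.X ^ i) = 0 :=
    AdjoinRoot.mk_eq_zero.mpr (Polynomial.cyclotomic_prime ℤ p).dvd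
  simpa only [map_sum, map_pow, AdjoinRoot.mk_X] using h

theorem rho_pow (p : ℕ) (hp : p.Prime) : rho p ^ p = 1 := by
  have h := mul_geom_sum (rho p) p
  rw [geom_sum_rho p hp, mul_zero] at h
  exact (sub_eq_zero.mp h.symm)

theorem x_pow_mul_y (p i : ℕ) : x p ^ (i + 1) * y p =
    rho p ^ (i + 1) • (y p * x p ^ (i + 1)) +
      (∑ j ∈ Finset.range (i + 1), rho p ^ j) • x p ^ i := by
  induction i with
  | zero => simpa using x_mul_y p
  | succ i ih =>
    rw [pow_succ' (x p) (i + 1), mul_assoc, ih, mul_add, mul_smul_comm, mul_smul_comm,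
      ← mul_assoc, x_mul_y, add_mul, smul_mul_assoc, one_mul, smul_add, smul_smul, ← pow_succ,
      mul_assoc, ← pow_succ', ← pow_succ', Finset.sum_range_succ _ (i + 1), add_smul]
    abel

theorem x_mul_y_pow (p i : ℕ) : x p * y p ^ (i + 1) =
    rho p ^ (i + 1) • (y p ^ (i + 1) * x p) +
      (∑ j ∈ Finset.range (i + 1), rho p ^ j) • y p ^ i := by
  induction i with
  | zero => simpa using x_mul_y p
  | succ i ih =>
    rw [pow_succ (y p) (i + 1), ← mul_assoc, ih, add_mul, smul_mul_assoc, smul_mul_assoc,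
      mul_assoc, x_mul_y, mul_add, mul_smul_comm, mul_one, smul_add, smul_smul, ← pow_succ,
      ← mul_assoc, ← pow_succ, ← pow_succ, Finset.sum_range_succ _ (i + 1), add_smul]
    abel

/-- An element that commutes with `x` and `y` is central. -/
theorem mem_center (p : ℕ) (z : B p) (hx : x p * z = z * x p) (hy : y p * z = z * y p) :
    z ∈ Subalgebra.center (ZRho p) (B p) := by
  rw [Subalgebra.mem_center_iff]
  intro b
  obtain ⟨a, rfl⟩ : ∃ a, mk p a = b := RingQuot.mkAlgHom_surjective (ZRho p) (Rel p) b
  induction a using FreeAlgebra.induction with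
  | grade0 r => rw [AlgHom.commutes]; exact Algebra.commutes r z
  | grade1 i => fin_cases i <;> [exact hx; exact hy]
  | mul a b ha hb => rw [map_mul, mul_assoc, hb, ← mul_assoc, ha, mul_assoc]
  | add a b ha hb => rw [map_add, add_mul, mul_add, ha, hb]

theorem x_pow_mem_center (p : ℕ) (hp : p.Prime) :
    x p ^ p ∈ Subalgebra.center (ZRho p) (B p) := by
  refine mem_center p _ (pow_mul_comm' (x p) p).symm ?_
  obtain ⟨i, hi⟩ : ∃ i, p = i + 1 := ⟨p - 1, (Nat.succ_pred hp.ne_zero).symm⟩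
  have h := x_pow_mul_y p i
  rw [← hi, rho_pow p hp, geom_sum_rho p hp, one_smul, zero_smul, add_zero] at h
  exact h.symm

theorem y_pow_mem_center (p : ℕ) (hp : p.Prime) :
    y p ^ p ∈ Subalgebra.center (ZRho p) (B p) := by
  refine mem_center p _ ?_ (pow_mul_comm' (y p) p).symm
  obtain ⟨i, hi⟩ : ∃ i, p = i + 1 := ⟨p - 1, (Nat.succ_pred hp.ne_zero).symm⟩
  have h := x_mul_y_pow p i
  rw [← hi, rho_pow p hp, geom_sum_rho p hp, one_smul, zero_smul, add_zero] at h
  exact h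

/-- The central element `s = x ^ p`. -/
noncomputable def s (p : ℕ) (hp : p.Prime) : C p := ⟨x p ^ p, x_pow_mem_center p hp⟩

/-- The central element `t = y ^ p`. -/
noncomputable def t (p : ℕ) (hp : p.Prime) : C p := ⟨y p ^ p, y_pow_mem_center p hp⟩

/-- The element `1 + (-1) ^ (p + 1) s t η ^ p` of `C`. For odd `p` it is `1 + s t η ^ p`, and for
`p = 2` (where `η = -2`) it is `1 - s t η ^ 2 = 1 - 4 s t`. -/
noncomputable def disc (p : ℕ) (hp : p.Prime) : C p :=
  1 + (-1) ^ (p + 1) * (s p hp * t p hp * algebraMap (ZRho p) (C p) (eta p) ^ p)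

/-- The Azumaya locus of an algebra `A` over a commutative ring `R`: the primes `P` of `R` such
that the localization `A_P = R_P ⊗ A` is an Azumaya algebra over the local ring `R_P`. -/
def azumayaLocus (R A : Type*) [CommRing R] [Ring A] [Algebra R A] : Set (PrimeSpectrum R) :=
  {P | IsAzumaya (Localization.AtPrime P.asIdeal) (Localization.AtPrime P.asIdeal ⊗[R] A)}

end CuriousAlgebra

/-!
Write `w = x y - y x = η y x + 1`. It satisfies `x w = ρ w x` and `w y = ρ y w`, so it is a normal
element of `B`, and `w ^ p` is central. Since `η x y = ρ w - 1`, moving factors one at a time gives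
`η ^ n x ^ n y ^ n = ∏_{1 ≤ i ≤ n} (ρ ^ i w - 1)`; for `n = p` the product is
`(-1) ^ p (1 - w ^ p)`, whence `w ^ p = π` (`CuriousAlgebra.commutator_pow`).

A representation on a free module shows that the `y ^ i x ^ j` form a basis of `B` over `ℤ[ρ]`
(`CuriousAlgebra.monomialBasis`). The sums `1 + ρ + ⋯ + ρ ^ (i - 1)` with `p ∤ i` are units, so
comparing coefficients in `x z = z x` and `z y = y z` leaves in a central `z` only exponents
divisible by `p`. Hence `C = ℤ[ρ][s, t]` (`CuriousAlgebra.centerMap_bijective`), and `B` is free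
over `C` on the `y ^ i x ^ j` with `i, j < p` (`CuriousAlgebra.centerBasis`).

Let `K` be any commutative `C`-algebra and `A = K ⊗ B`. Then `A` is Azumaya over `K` if and only
if the image of `π` in `K` is a unit (`QWeyl.isAzumaya_iff`); the localizations of `C` are special
cases.

* If `π` is a unit, so is `w`. Up to units, `w⁻¹ [x, ·]` and `[·, y] w⁻¹` lower by one the exponent
  of `y`, respectively `x`, in the basis monomials, so their iterates give the functional
  "coefficient of `y ^ (p - 1) x ^ (p - 1)`" as a two-sided multiplication operator. Multiplying by
  powers of `x` and `y` beforehand turns it into every other coordinate functional, so every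
  endomorphism of `A` is a sum of two-sided multiplications. Thus `A ⊗ Aᵒᵖ → End A` is surjective,
  and bijective because both sides are free of rank `p ^ 4`.
* If `A` is Azumaya, some sum of two-sided multiplications sends `w`, whose constant coefficient
  is `1`, to `1`. It preserves the two-sided ideal `w A`, so `w a = 1` for some `a`; therefore
  `π = w ^ p` has a right inverse in `A`, and its constant coefficient inverts `π` in `K`.
-/

open scoped TensorProduct

/-! ### The relation `x y = q y x + 1` in an arbitrary algebra -/

namespace QWeyl

open Finset

section Relation

variable {K A : Type*} [CommRing K] [Ring A] [Algebra K A] {q : K} {x y : A}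

theorem commutator_eq (h : x * y = q • (y * x) + 1) :
    x * y - y * x = (q - 1) • (y * x) + 1 := by
  rw [h, sub_smul, one_smul]; abel

theorem x_mul_commutator (h : x * y = q • (y * x) + 1) :
    x * (x * y - y * x) = q • ((x * y - y * x) * x) := by
  have h2 : x * (y * x) = q • (y * x * x) + x := by
    rw [← mul_assoc, h, add_mul, smul_mul_assoc, one_mul]
  rw [commutator_eq h, mul_add, mul_smul_comm, h2, add_mul, smul_mul_assoc]
  simp only [mul_one, one_mul]
  module

theorem commutator_mul_y (h : x * y = q • (y * x) + 1) :
    (x * y - y * x) * y = q • (y * (x * y - y * x)) := by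
  have h2 : (y * x) * y = q • (y * (y * x)) + y := by
    rw [mul_assoc, h, mul_add, mul_smul_comm, mul_one]
  rw [commutator_eq h, add_mul, smul_mul_assoc, h2, mul_add, mul_smul_comm]
  simp only [mul_one, one_mul]
  module

theorem x_pow_mul_commutator (h : x * y = q • (y * x) + 1) (n : ℕ) :
    x ^ n * (x * y - y * x) = q ^ n • ((x * y - y * x) * x ^ n) := by
  induction n with
  | zero => simp
  | succ n ih =>
    rw [pow_succ x, mul_assoc, x_mul_commutator h, mul_smul_comm, ← mul_assoc, ih,
      smul_mul_assoc, smul_smul, mul_assoc, pow_succ' q]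

theorem commutator_mul_y_pow (h : x * y = q • (y * x) + 1) (n : ℕ) :
    (x * y - y * x) * y ^ n = q ^ n • (y ^ n * (x * y - y * x)) := by
  induction n with
  | zero => simp
  | succ n ih =>
    rw [pow_succ y, ← mul_assoc, ih, smul_mul_assoc, mul_assoc, commutator_mul_y h,
      mul_smul_comm, smul_smul, mul_assoc, pow_succ q]

/-- The inner derivation `[x, ·]` lowers the exponent of `y`, at the cost of a factor `x y - y x`. -/
theorem x_mul_y_pow_sub (h : x * y = q • (y * x) + 1) (n : ℕ) :
    x * y ^ (n + 1) - y ^ (n + 1) * x =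
      (∑ i ∈ range (n + 1), q ^ i) • (y ^ n * (x * y - y * x)) := by
  induction n with
  | zero => simp
  | succ n ih =>
    have e : x * y ^ (n + 1 + 1) - y ^ (n + 1 + 1) * x =
        (x * y ^ (n + 1) - y ^ (n + 1) * x) * y + y ^ (n + 1) * (x * y - y * x) := by
      rw [pow_succ y (n + 1)]; noncomm_ring
    rw [e, ih, smul_mul_assoc, mul_assoc, commutator_mul_y h, mul_smul_comm, smul_smul,
      ← mul_assoc, ← pow_succ, geom_sum_succ (n := n + 1), mul_comm q, add_smul, one_smul]

theorem x_pow_mul_y_sub (h : x * y = q • (y * x) + 1) (n : ℕ) :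
    x ^ (n + 1) * y - y * x ^ (n + 1) =
      (∑ i ∈ range (n + 1), q ^ i) • ((x * y - y * x) * x ^ n) := by
  induction n with
  | zero => simp
  | succ n ih =>
    have e : x ^ (n + 1 + 1) * y - y * x ^ (n + 1 + 1) =
        x * (x ^ (n + 1) * y - y * x ^ (n + 1)) + (x * y - y * x) * x ^ (n + 1) := by
      rw [pow_succ' x (n + 1)]; noncomm_ring
    rw [e, ih, mul_smul_comm, ← mul_assoc, x_mul_commutator h, smul_mul_assoc, smul_smul,
      mul_assoc, ← pow_succ', geom_sum_succ (n := n + 1), mul_comm q, add_smul, one_smul]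

/-- Moving one more factor `x y` inside `x ^ n (x y) y ^ n` multiplies by a linear polynomial in
the commutator `w = x y - y x`, because `(q - 1) x y = q w - 1`. -/
theorem aeval_commutator_prod (h : x * y = q • (y * x) + 1) (n : ℕ) :
    Polynomial.aeval (x * y - y * x)
        (∏ i ∈ range n, (Polynomial.C (q ^ (i + 1)) * Polynomial.X - 1)) =
      (q - 1) ^ n • (x ^ n * y ^ n) := by
  induction n with
  | zero => simp
  | succ n ih =>
    have hxy : (q - 1) • (x * y) = q • (x * y - y * x) - 1 := by
      rw [sub_smul, one_smul, smul_sub]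
      nth_rewrite 2 [h]
      abel
    rw [prod_range_succ, mul_comm, map_mul, ih, pow_succ x, pow_succ' y, pow_succ (q - 1),
      show x ^ n * x * (y * y ^ n) = x ^ n * (x * y) * y ^ n by noncomm_ring,
      mul_smul, ← smul_mul_assoc (q - 1), ← mul_smul_comm (q - 1) (x ^ n), hxy, mul_sub,
      mul_smul_comm q (x ^ n),
      x_pow_mul_commutator h, smul_smul, mul_one, sub_mul, smul_mul_assoc, ← pow_succ']
    simp only [map_sub, map_mul, Polynomial.aeval_C, Polynomial.aeval_X, map_one, sub_mul, one_mul,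
      mul_smul_comm, smul_sub, Algebra.algebraMap_eq_smul_one, smul_mul_assoc, mul_assoc]

end Relation

/-! ### The Azumaya property for an algebra with basis `y ^ i x ^ j` -/

/-- If `f` lowers the index of a sequence by one, up to scalars `c n`, then `f ^ n` kills the terms
of index below `n` and takes the `n`-th term to a multiple of the first. -/
theorem pow_apply_lowering {K M : Type*} [CommRing K] [AddCommGroup M] [Module K M]
    (f : Module.End K M) (e : ℕ → M) (c : ℕ → K) (h0 : f (e 0) = 0)
    (h : ∀ n, f (e (n + 1)) = c n • e n) (n : ℕ) :
    (∀ m < n, (f ^ n) (e m) = 0) ∧ (f ^ n) (e n) = (∏ i ∈ range n, c i) • e 0 := by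
  induction n with
  | zero => simp
  | succ n ih =>
    refine ⟨fun m hm => ?_, ?_⟩
    · rw [pow_succ, Module.End.mul_apply]
      cases m with
      | zero => rw [h0, map_zero]
      | succ m => rw [h, map_smul, ih.1 m (by omega), smul_zero]
    · rw [pow_succ, Module.End.mul_apply, h, map_smul, ih.2, smul_smul, prod_range_succ, mul_comm]

section Azumaya

variable {K A : Type*} [CommRing K] [Ring A] [Algebra K A] {q : K} {x y : A} {p : ℕ}

theorem mulLeft_mem_range (a : A) :
    LinearMap.mulLeft K a ∈ (AlgHom.mulLeftRight K A).range :=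
  ⟨a ⊗ₜ MulOpposite.op 1, by ext; simp⟩

theorem mulRight_mem_range (a : A) :
    LinearMap.mulRight K a ∈ (AlgHom.mulLeftRight K A).range :=
  ⟨1 ⊗ₜ MulOpposite.op a, by ext; simp⟩

/-- If the commutator `w = x y - y x` is invertible, then `w⁻¹ [x, ·]` and `[·, y] w⁻¹` lower the
exponents of `y` and of `x` in the monomials `y ^ i x ^ j`, with unit coefficients. Their iterates
yield the functional picking out the coefficient of `y ^ (p - 1) x ^ (p - 1)`. -/
theorem exists_mem_range_top_coeff (h : x * y = q • (y * x) + 1) (hq : IsUnit q)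
    (hn : ∀ n, 0 < n → n < p → IsUnit (∑ i ∈ range n, q ^ i)) (hw : IsUnit (x * y - y * x)) :
    ∃ e ∈ (AlgHom.mulLeftRight K A).range, ∀ i < p, ∀ j < p,
      e (y ^ i * x ^ j) = if i + 1 = p ∧ j + 1 = p then 1 else 0 := by
  obtain ⟨w, hw⟩ := hw
  obtain ⟨u, rfl⟩ := hq
  have hyw (n : ℕ) : y ^ n * w = (↑(u⁻¹ ^ n) : K) • (w * y ^ n) := by
    rw [hw, commutator_mul_y_pow h, smul_smul, ← Units.val_pow_eq_pow_val, ← Units.val_mul]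
    simp
  have hwx (n : ℕ) : w * x ^ n = (↑(u⁻¹ ^ n) : K) • (x ^ n * w) := by
    rw [hw, x_pow_mul_commutator h, smul_smul, ← Units.val_pow_eq_pow_val, ← Units.val_mul]
    simp
  let Dx : Module.End K A := LinearMap.mulLeft K (↑w⁻¹ : A) *
    (LinearMap.mulLeft K x - LinearMap.mulRight K x)
  let Dy : Module.End K A := LinearMap.mulRight K (↑w⁻¹ : A) *
    (LinearMap.mulRight K y - LinearMap.mulLeft K y)
  let c : ℕ → K := fun n => (∑ i ∈ range (n + 1), (u : K) ^ i) * ↑(u⁻¹ ^ n)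
  have hc : IsUnit (∏ i ∈ range (p - 1), c i) := by
    rw [IsUnit.prod_iff]
    intro i hi
    have := mem_range.1 hi
    exact (hn _ i.succ_pos (by omega)).mul (Units.isUnit _)
  have hDx (j : ℕ) := pow_apply_lowering Dx (fun n => y ^ n * x ^ j) c
    (by simp [Dx, (pow_mul_comm' x j).symm])
    (fun n => by
      simp only [Dx, Module.End.mul_apply, LinearMap.sub_apply, LinearMap.mulLeft_apply,
        LinearMap.mulRight_apply, c]
      rw [show x * (y ^ (n + 1) * x ^ j) - y ^ (n + 1) * x ^ j * x =
        (x * y ^ (n + 1) - y ^ (n + 1) * x) * x ^ j by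
          rw [sub_mul, mul_assoc, mul_assoc, mul_assoc, pow_mul_comm'], x_mul_y_pow_sub h, ← hw,
        hyw, smul_smul, smul_mul_assoc, mul_smul_comm, mul_assoc, Units.inv_mul_cancel_left])
    (p - 1)
  have hDy := pow_apply_lowering Dy (fun n => x ^ n) c
    (by simp [Dy])
    (fun n => by
      simp only [Dy, Module.End.mul_apply, LinearMap.sub_apply, LinearMap.mulLeft_apply,
        LinearMap.mulRight_apply, c]
      rw [x_pow_mul_y_sub h, ← hw, hwx, smul_smul, smul_mul_assoc, Units.mul_inv_cancel_right])
    (p - 1)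
  obtain ⟨v, hv⟩ := hc
  have hmemx : Dx ∈ (AlgHom.mulLeftRight K A).range :=
    mul_mem (mulLeft_mem_range _) (sub_mem (mulLeft_mem_range _) (mulRight_mem_range _))
  have hmemy : Dy ∈ (AlgHom.mulLeftRight K A).range :=
    mul_mem (mulRight_mem_range _) (sub_mem (mulRight_mem_range _) (mulLeft_mem_range _))
  refine ⟨(↑(v⁻¹ * v⁻¹) : K) • (Dy ^ (p - 1) * Dx ^ (p - 1)),
    Subalgebra.smul_mem _ (mul_mem (pow_mem hmemy _) (pow_mem hmemx _)) _, fun i hi j hj => ?_⟩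
  rw [LinearMap.smul_apply, Module.End.mul_apply]
  by_cases hi' : i + 1 = p
  · obtain rfl : i = p - 1 := by omega
    have e := (hDx j).2
    simp only [pow_zero, one_mul] at e
    rw [e, map_smul]
    by_cases hj' : j + 1 = p
    · obtain rfl : j = p - 1 := by omega
      rw [hDy.2, if_pos ⟨hi', hj'⟩, ← hv, pow_zero, smul_smul, smul_smul, ← Units.val_mul,
        ← Units.val_mul]
      simp
    · rw [hDy.1 j (by omega), if_neg (by tauto), smul_zero, smul_zero]
  · rw [(hDx j).1 i (by omega), map_zero, smul_zero, if_neg (by tauto)]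

/-- If `y ^ i x ^ j` for `i, j < p` is a basis, with `x ^ p` and `y ^ p` scalars, then every linear
endomorphism is a sum of two-sided multiplications: shifting exponents before applying the top
coefficient functional gives all the coordinate functionals. -/
theorem mulLeftRight_surjective (h : x * y = q • (y * x) + 1) (hq : IsUnit q)
    (hn : ∀ n, 0 < n → n < p → IsUnit (∑ i ∈ range n, q ^ i)) (hw : IsUnit (x * y - y * x))
    (b : Module.Basis (Fin p × Fin p) K A) (hb : ∀ i, b i = y ^ (i.1 : ℕ) * x ^ (i.2 : ℕ))
    {s t : K} (hs : x ^ p = algebraMap K A s) (ht : y ^ p = algebraMap K A t) :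
    Function.Surjective (AlgHom.mulLeftRight K A) := by
  obtain ⟨e, he, htop⟩ := exists_mem_range_top_coeff h hq hn hw
  -- The exponents after a shift are at most `2 p - 2`; those beyond `p - 1` are reduced by `p`,
  -- which leaves them below `p - 1`.
  have htop1 : ∀ i < 2 * p - 1, ∀ j < p,
      e (y ^ i * x ^ j) = if i + 1 = p ∧ j + 1 = p then 1 else 0 := by
    intro i hi j hj
    rcases lt_or_ge i p with hip | hip
    · exact htop i hip j hj
    · obtain ⟨k, rfl⟩ := Nat.exists_eq_add_of_le hip
      rw [pow_add, ht, mul_assoc, ← Algebra.smul_def, map_smul, htop k (by omega) j hj,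
        if_neg (by omega), if_neg (by omega), smul_zero]
  have htop2 : ∀ i < 2 * p - 1, ∀ j < 2 * p - 1,
      e (y ^ i * x ^ j) = if i + 1 = p ∧ j + 1 = p then 1 else 0 := by
    intro i hi j hj
    rcases lt_or_ge j p with hjp | hjp
    · exact htop1 i hi j hjp
    · obtain ⟨k, rfl⟩ := Nat.exists_eq_add_of_le hjp
      rw [pow_add, hs, Algebra.left_comm, ← Algebra.smul_def, map_smul, htop1 i hi k (by omega),
        if_neg (by omega), if_neg (by omega), smul_zero]
  let f (i : Fin p × Fin p) : Module.End K A := e *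
    (LinearMap.mulLeft K (y ^ (p - 1 - i.1)) * LinearMap.mulRight K (x ^ (p - 1 - i.2)))
  have hf (i : Fin p × Fin p) : f i ∈ (AlgHom.mulLeftRight K A).range :=
    mul_mem he (mul_mem (mulLeft_mem_range _) (mulRight_mem_range _))
  have hfb (i j : Fin p × Fin p) : f i (b j) = if i = j then 1 else 0 := by
    obtain ⟨⟨i₁, hi₁⟩, i₂, hi₂⟩ := i
    obtain ⟨⟨j₁, hj₁⟩, j₂, hj₂⟩ := j
    simp only [f, hb, Module.End.mul_apply, LinearMap.mulLeft_apply, LinearMap.mulRight_apply]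
    rw [mul_assoc, ← mul_assoc, ← pow_add, ← pow_add, htop2 _ (by omega) _ (by omega)]
    refine if_congr ?_ rfl rfl
    simp only [Prod.mk.injEq, Fin.mk.injEq]
    omega
  intro g
  have hg : g = ∑ i, LinearMap.mulLeft K (g (b i)) * f i := by
    refine b.ext fun j => ?_
    simp [LinearMap.sum_apply, hfb]
  change g ∈ (AlgHom.mulLeftRight K A).range
  rw [hg]
  exact sum_mem fun i _ => mul_mem (mulLeft_mem_range _) (hf i)

/-- For a finite free algebra, surjectivity of `A ⊗ Aᵒᵖ → End A` suffices, as both sides are free of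
the same finite rank. -/
theorem isAzumaya_of_surjective {ι : Type*} [Finite ι]
    (b : Module.Basis ι K A) (i : ι)
    (hs : Function.Surjective (AlgHom.mulLeftRight K A)) : IsAzumaya K A := by
  classical
  cases nonempty_fintype ι
  have : Module.Free K A := .of_basis b
  have : Module.Finite K A := .of_basis b
  have : FaithfulSMul K A := ⟨fun {r r'} h => by
    have := congrArg (fun a => b.repr a i) (h (b i))
    simpa using this⟩
  let b₁ := b.tensorProduct (b.map (MulOpposite.opLinearEquiv K))
  let b₂ := (Matrix.stdBasis K ι ι).map (LinearMap.toMatrix b b).symm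
  have inj := OrzechProperty.injective_of_surjective_of_injective
    (b₁.equiv b₂ (Equiv.refl _)).toLinearMap (AlgHom.mulLeftRight K A).toLinearMap
    (LinearEquiv.injective _) hs
  exact { bij := ⟨inj, hs⟩ }

/-- The commutator `w = x y - y x` generates a two-sided ideal, which two-sided multiplications
preserve. If these exhaust all endomorphisms, one of them takes `w`, whose constant coefficient
is `1`, to `1`. -/
theorem exists_commutator_mul_eq_one [IsAzumaya K A] (h : x * y = q • (y * x) + 1)
    (hq : IsUnit q) (hp : 1 < p)
    (b : Module.Basis (Fin p × Fin p) K A) (hb : ∀ i, b i = y ^ (i.1 : ℕ) * x ^ (i.2 : ℕ)) :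
    ∃ a, (x * y - y * x) * a = 1 := by
  have normal (a : A) : ∃ a', a * (x * y - y * x) = (x * y - y * x) * a' := by
    induction b.mem_span a using Submodule.span_induction with
    | mem a ha =>
      obtain ⟨i, rfl⟩ := ha
      obtain ⟨u, rfl⟩ := hq
      refine ⟨(u : K) ^ (i.2 : ℕ) • (↑(u⁻¹ ^ (i.1 : ℕ)) : K) • b i, ?_⟩
      have e : y ^ (i.1 : ℕ) * (x * y - y * x) =
          (↑(u⁻¹ ^ (i.1 : ℕ)) : K) • ((x * y - y * x) * y ^ (i.1 : ℕ)) := by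
        rw [commutator_mul_y_pow h, smul_smul, ← Units.val_pow_eq_pow_val, ← Units.val_mul]
        simp
      rw [hb, mul_assoc, x_pow_mul_commutator h, mul_smul_comm, ← mul_assoc, e, smul_mul_assoc,
        mul_smul_comm, mul_smul_comm, mul_assoc]
    | zero => exact ⟨0, by simp⟩
    | add a a' _ _ ha ha' =>
      obtain ⟨c, hc⟩ := ha
      obtain ⟨c', hc'⟩ := ha'
      exact ⟨c + c', by rw [add_mul, hc, hc', mul_add]⟩
    | smul r a _ ha =>
      obtain ⟨c, hc⟩ := ha
      exact ⟨r • c, by rw [smul_mul_assoc, hc, mul_smul_comm]⟩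
  have ideal (z : A ⊗[K] Aᵐᵒᵖ) :
      ∃ a, AlgHom.mulLeftRight K A z (x * y - y * x) = (x * y - y * x) * a := by
    induction z using TensorProduct.induction_on with
    | zero => exact ⟨0, by simp⟩
    | tmul a c =>
      obtain ⟨a', ha'⟩ := normal a
      exact ⟨a' * c.unop, by rw [AlgHom.mulLeftRight_apply, ha', mul_assoc]⟩
    | add z z' hz hz' =>
      obtain ⟨c, hc⟩ := hz
      obtain ⟨c', hc'⟩ := hz'
      exact ⟨c + c', by rw [map_add, LinearMap.add_apply, hc, hc', mul_add]⟩
  let o : Fin p × Fin p := (⟨0, by omega⟩, ⟨0, by omega⟩)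
  let d : Fin p × Fin p := (⟨1, hp⟩, ⟨1, hp⟩)
  have ho : b o = 1 := by simp [hb, o]
  have hd : b d = y * x := by simp [hb, d]
  have hdo : d ≠ o := by simp [d, o]
  -- The endomorphism `a ↦ (constant coefficient of a) • 1` takes the commutator to `1`.
  obtain ⟨z, hz⟩ := (IsAzumaya.bij (R := K) (A := A)).2 ((b.coord o).smulRight 1)
  obtain ⟨a, ha⟩ := ideal z
  refine ⟨a, ?_⟩
  rw [← ha, hz, LinearMap.smulRight_apply, commutator_eq h, ← hd, ← ho]
  simp [Module.Basis.coord_apply, hdo]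

/-- The algebra with basis `y ^ i x ^ j` is Azumaya exactly when the `p`-th power of the commutator
`x y - y x` is an invertible scalar. -/
theorem isAzumaya_iff (h : x * y = q • (y * x) + 1) (hq : IsUnit q) (hp : 1 < p)
    (hn : ∀ n, 0 < n → n < p → IsUnit (∑ i ∈ range n, q ^ i))
    (b : Module.Basis (Fin p × Fin p) K A) (hb : ∀ i, b i = y ^ (i.1 : ℕ) * x ^ (i.2 : ℕ))
    {s t d : K} (hs : x ^ p = algebraMap K A s) (ht : y ^ p = algebraMap K A t)
    (hd : (x * y - y * x) ^ p = algebraMap K A d) : IsAzumaya K A ↔ IsUnit d := by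
  let o : Fin p × Fin p := (⟨0, by omega⟩, ⟨0, by omega⟩)
  have ho : b o = 1 := by simp [hb, o]
  refine ⟨fun _ => ?_, fun hu => ?_⟩
  · obtain ⟨a, ha⟩ := exists_commutator_mul_eq_one h hq hp b hb
    have hpow (n : ℕ) : ∃ c, (x * y - y * x) ^ n * c = 1 := by
      induction n with
      | zero => exact ⟨1, by simp⟩
      | succ n ih =>
        obtain ⟨c, hc⟩ := ih
        exact ⟨a * c, by rw [pow_succ, mul_assoc, ← mul_assoc _ a, ha, one_mul, hc]⟩
    obtain ⟨c, hc⟩ := hpow p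
    rw [hd, ← Algebra.smul_def, ← ho] at hc
    refine IsUnit.of_mul_eq_one (b.repr c o) ?_
    simpa using congrArg (fun a => b.repr a o) hc
  · have hw : IsUnit (x * y - y * x) :=
      (isUnit_pow_iff (by omega)).1 (hd ▸ hu.map (algebraMap K A))
    exact isAzumaya_of_surjective b o (mulLeftRight_surjective h hq hn hw b hb hs ht)

end Azumaya

end QWeyl

namespace CuriousAlgebra

open Finset

/-! ### The cyclotomic ring `ℤ[ρ]` -/

theorem isDomain_zRho (p : ℕ) (hp : p.Prime) : IsDomain (ZRho p) :=
  AdjoinRoot.isDomain_of_prime (Polynomial.cyclotomic.irreducible hp.pos).prime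

theorem isPrimitiveRoot_rho (p : ℕ) (hp : p.Prime) : IsPrimitiveRoot (rho p) p := by
  have := isDomain_zRho p hp
  have hinj : Function.Injective (AdjoinRoot.of (Polynomial.cyclotomic p ℤ)) :=
    AdjoinRoot.of.injective_of_degree_ne_zero (Polynomial.degree_cyclotomic_pos p ℤ hp.pos).ne'
  have : NeZero (p : ZRho p) := ⟨fun h => by
    rw [← map_natCast (AdjoinRoot.of (Polynomial.cyclotomic p ℤ)),
      map_eq_zero_iff _ hinj] at h
    exact hp.ne_zero (by exact_mod_cast h)⟩
  rw [← Polynomial.isRoot_cyclotomic_iff, Polynomial.IsRoot.def,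
    ← Polynomial.map_cyclotomic p (AdjoinRoot.of (Polynomial.cyclotomic p ℤ)),
    Polynomial.eval_map, AdjoinRoot.eval₂_root]

theorem isUnit_rho (p : ℕ) (hp : p.Prime) : IsUnit (rho p) :=
  (isPrimitiveRoot_rho p hp).isUnit hp.ne_zero

theorem isUnit_geom_sum_rho (p : ℕ) (hp : p.Prime) (n : ℕ) (h0 : 0 < n) (hn : n < p) :
    IsUnit (∑ i ∈ range n, rho p ^ i) :=
  have := isDomain_zRho p hp
  (isPrimitiveRoot_rho p hp).geom_sum_isUnit hp.two_le
    ((hp.coprime_iff_not_dvd.2 (Nat.not_dvd_of_pos_of_lt h0 hn)).symm)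

theorem geom_sum_rho_mod (p : ℕ) (hp : p.Prime) (n : ℕ) :
    ∑ i ∈ range n, rho p ^ i = ∑ i ∈ range (n % p), rho p ^ i := by
  conv_lhs => rw [← Nat.mod_add_div n p, sum_range_add]
  have h (k : ℕ) : ∑ i ∈ range (p * k), rho p ^ i = 0 := by
    induction k with
    | zero => simp
    | succ k ih =>
      rw [mul_add, mul_one, sum_range_add, ih, zero_add]
      simp_rw [pow_add, ← mul_sum]
      rw [geom_sum_rho p hp, mul_zero]
  simp_rw [pow_add, ← mul_sum]
  rw [h, mul_zero, add_zero]

theorem isUnit_geom_sum_rho_of_not_dvd (p : ℕ) (hp : p.Prime) {n : ℕ} (hn : ¬ p ∣ n) :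
    IsUnit (∑ i ∈ range n, rho p ^ i) := by
  rw [geom_sum_rho_mod p hp]
  exact isUnit_geom_sum_rho p hp _ (Nat.pos_of_ne_zero fun h => hn (Nat.dvd_of_mod_eq_zero h))
    (Nat.mod_lt _ hp.pos)

/-- The factorization `1 - Z ^ p = ∏ (1 - ρ ^ i Z)`, with the signs of the factors changed. -/
theorem prod_rho_pow_mul_X_sub_one (p : ℕ) (hp : p.Prime) :
    ∏ i ∈ range p, (Polynomial.C (rho p ^ (i + 1)) * Polynomial.X - 1) =
      (-1) ^ p * (1 - Polynomial.X ^ p) := by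
  have := isDomain_zRho p hp
  have hρ := isPrimitiveRoot_rho p hp
  have : NeZero p := ⟨hp.ne_zero⟩
  have hC : IsPrimitiveRoot (Polynomial.C (rho p)) p :=
    hρ.map_of_injective Polynomial.C_injective
  have h := hC.pow_sub_pow_eq_prod_sub_mul 1 Polynomial.X hp.pos
  rw [one_pow] at h
  rw [h, show (-1 : Polynomial (ZRho p)) ^ p = ∏ _i ∈ range p, (-1) by simp]
  have himg : Polynomial.nthRootsFinset p (1 : Polynomial (ZRho p)) =
      (range p).image fun i => Polynomial.C (rho p) ^ (i + 1) := by
    ext ζ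
    rw [Polynomial.mem_nthRootsFinset hp.pos, mem_image]
    constructor
    · intro hζ
      obtain ⟨i, hi, hiζ⟩ := hC.eq_pow_of_pow_eq_one (ξ := Polynomial.C (rho p) ^ (p - 1) * ζ)
        (by rw [mul_pow, hζ, ← pow_mul, mul_comm (p - 1), pow_mul, hC.pow_eq_one,
          one_pow, mul_one])
      refine ⟨i, mem_range.2 hi, ?_⟩
      rw [pow_succ', hiζ, ← mul_assoc, ← pow_succ', Nat.sub_add_cancel hp.one_le, hC.pow_eq_one,
        one_mul]
    · rintro ⟨i, -, rfl⟩
      rw [← pow_mul, mul_comm, pow_mul, hC.pow_eq_one, one_pow]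
  rw [himg, prod_image, ← prod_mul_distrib]
  · refine prod_congr rfl fun i _ => ?_
    rw [Polynomial.C_pow]; ring
  · intro i hi j hj hij
    simp only [pow_succ] at hij
    exact hC.pow_inj (mem_range.1 hi) (mem_range.1 hj)
      ((hC.isUnit hp.ne_zero).mul_right_cancel hij)

/-! ### The basis `y ^ i x ^ j` of `B` over `ℤ[ρ]` -/

/-- Left multiplication by `x` in the basis `y ^ i x ^ j`. For `i = 0` the second coefficient is the
empty sum, so the truncated difference `i - 1` does not matter. -/
noncomputable def xEnd (p : ℕ) : Module.End (ZRho p) (ℕ × ℕ →₀ ZRho p) :=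
  Finsupp.linearCombination (ZRho p) fun i : ℕ × ℕ =>
    rho p ^ i.1 • Finsupp.single (i.1, i.2 + 1) (1 : ZRho p) +
      (∑ k ∈ range i.1, rho p ^ k) • Finsupp.single (i.1 - 1, i.2) 1

/-- Left multiplication by `y` in the basis `y ^ i x ^ j`. -/
noncomputable def yEnd (p : ℕ) : Module.End (ZRho p) (ℕ × ℕ →₀ ZRho p) :=
  Finsupp.linearCombination (ZRho p) fun i : ℕ × ℕ => Finsupp.single (i.1 + 1, i.2) (1 : ZRho p)

theorem xEnd_single (p i j : ℕ) : xEnd p (Finsupp.single (i, j) 1) =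
    rho p ^ i • Finsupp.single (i, j + 1) (1 : ZRho p) +
      (∑ k ∈ range i, rho p ^ k) • Finsupp.single (i - 1, j) 1 := by
  simp [xEnd]

theorem yEnd_single (p i j : ℕ) :
    yEnd p (Finsupp.single (i, j) 1) = Finsupp.single (i + 1, j) (1 : ZRho p) := by
  simp [yEnd]

theorem xEnd_mul_yEnd (p : ℕ) : xEnd p * yEnd p = rho p • (yEnd p * xEnd p) + 1 := by
  refine Finsupp.lhom_ext' fun ⟨i, j⟩ => LinearMap.ext_ring ?_
  simp only [LinearMap.comp_apply, Finsupp.lsingle_apply, LinearMap.add_apply,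
    LinearMap.smul_apply, Module.End.mul_apply, Module.End.one_apply, xEnd_single, yEnd_single,
    map_add, map_smul]
  rw [geom_sum_succ]
  cases i with
  | zero => simp
  | succ i =>
    simp only [Nat.add_sub_cancel]
    module

/-- The action of `B` on the free module with basis the would-be monomials `y ^ i x ^ j`. -/
noncomputable def rep (p : ℕ) : B p →ₐ[ZRho p] Module.End (ZRho p) (ℕ × ℕ →₀ ZRho p) :=
  RingQuot.liftAlgHom (ZRho p) ⟨FreeAlgebra.lift (ZRho p) ![xEnd p, yEnd p], fun _ _ h => by
    cases h
    simpa using xEnd_mul_yEnd p⟩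

theorem rep_mk (p : ℕ) (a : FreeAlgebra (ZRho p) (Fin 2)) :
    rep p (mk p a) = FreeAlgebra.lift (ZRho p) ![xEnd p, yEnd p] a :=
  RingQuot.liftAlgHom_mkAlgHom_apply _ _ _ _

theorem rep_x (p : ℕ) : rep p (x p) = xEnd p := by simp [x, rep_mk]

theorem rep_y (p : ℕ) : rep p (y p) = yEnd p := by simp [y, rep_mk]

theorem rep_monomial (p i j : ℕ) :
    rep p (y p ^ i * x p ^ j) (Finsupp.single (0, 0) 1) = Finsupp.single (i, j) 1 := by
  have hx (j : ℕ) : (xEnd p ^ j) (Finsupp.single (0, 0) 1) = Finsupp.single (0, j) 1 := by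
    induction j with
    | zero => simp
    | succ j ih => rw [pow_succ', Module.End.mul_apply, ih, xEnd_single]; simp
  have hy (i : ℕ) : (yEnd p ^ i) (Finsupp.single (0, j) 1) = Finsupp.single (i, j) 1 := by
    induction i with
    | zero => simp
    | succ i ih => rw [pow_succ', Module.End.mul_apply, ih, yEnd_single]
  rw [map_mul, map_pow, map_pow, rep_x, rep_y, Module.End.mul_apply, hx, hy]

theorem x_mul_monomial (p i j : ℕ) : x p * (y p ^ i * x p ^ j) =
    rho p ^ i • (y p ^ i * x p ^ (j + 1)) +
      (∑ k ∈ range i, rho p ^ k) • (y p ^ (i - 1) * x p ^ j) := by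
  cases i with
  | zero => simp [pow_succ']
  | succ i =>
    rw [← mul_assoc, x_mul_y_pow, add_mul, smul_mul_assoc, smul_mul_assoc, mul_assoc,
      ← pow_succ', Nat.add_sub_cancel]

theorem linearIndependent_monomial (p : ℕ) :
    LinearIndependent (ZRho p) fun i : ℕ × ℕ => y p ^ i.1 * x p ^ i.2 := by
  refine LinearIndependent.of_comp
    ((LinearMap.applyₗ (Finsupp.single (0, 0) 1)).comp (rep p).toLinearMap) ?_
  have : (((LinearMap.applyₗ (Finsupp.single (0, 0) 1)).comp (rep p).toLinearMap) ∘
      fun i : ℕ × ℕ => y p ^ i.1 * x p ^ i.2) = fun i => Finsupp.single i 1 :=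
    funext fun i => rep_monomial p i.1 i.2
  rw [this]
  exact Finsupp.linearIndependent_single_one _ _

theorem span_monomial (p : ℕ) :
    ⊤ ≤ Submodule.span (ZRho p) (Set.range fun i : ℕ × ℕ => y p ^ i.1 * x p ^ i.2) := by
  set S := Submodule.span (ZRho p) (Set.range fun i : ℕ × ℕ => y p ^ i.1 * x p ^ i.2)
  have hmem (i j : ℕ) : y p ^ i * x p ^ j ∈ S := Submodule.subset_span ⟨(i, j), rfl⟩
  have hmul (c : B p) (hc : ∀ i j, c * (y p ^ i * x p ^ j) ∈ S) : ∀ b ∈ S, c * b ∈ S := by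
    intro b hb
    induction hb using Submodule.span_induction with
    | mem b hb => obtain ⟨i, rfl⟩ := hb; exact hc _ _
    | zero => rw [mul_zero]; exact zero_mem _
    | add b b' _ _ h h' => rw [mul_add]; exact add_mem h h'
    | smul r b _ h => rw [mul_smul_comm]; exact Submodule.smul_mem _ _ h
  have key (a : FreeAlgebra (ZRho p) (Fin 2)) : ∀ b ∈ S, mk p a * b ∈ S := by
    induction a using FreeAlgebra.induction with
    | grade0 r =>
      intro b hb
      rw [AlgHom.commutes, ← Algebra.smul_def]
      exact Submodule.smul_mem _ _ hb
    | grade1 i =>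
      fin_cases i
      · refine hmul (x p) fun i j => ?_
        rw [x_mul_monomial]
        exact add_mem (Submodule.smul_mem _ _ (hmem _ _)) (Submodule.smul_mem _ _ (hmem _ _))
      · refine hmul (y p) fun i j => ?_
        rw [← mul_assoc, ← pow_succ']
        exact hmem _ _
    | mul a a' h h' => intro b hb; rw [map_mul, mul_assoc]; exact h _ (h' _ hb)
    | add a a' h h' => intro b hb; rw [map_add, add_mul]; exact add_mem (h _ hb) (h' _ hb)
  intro b _
  obtain ⟨a, rfl⟩ : ∃ a, mk p a = b := RingQuot.mkAlgHom_surjective (ZRho p) (Rel p) b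
  simpa using key a 1 (by simpa using hmem 0 0)

/-- The monomials `y ^ i x ^ j` form a basis of `B` over `ℤ[ρ]`. -/
noncomputable def monomialBasis (p : ℕ) : Module.Basis (ℕ × ℕ) (ZRho p) (B p) :=
  .mk (linearIndependent_monomial p) (span_monomial p)

theorem monomialBasis_apply (p : ℕ) (i : ℕ × ℕ) :
    monomialBasis p i = y p ^ i.1 * x p ^ i.2 := by
  simp [monomialBasis]

/-! ### The center of `B` -/

theorem monomial_mul_y (p i j : ℕ) : y p ^ i * x p ^ j * y p =
    rho p ^ j • (y p ^ (i + 1) * x p ^ j) +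
      (∑ k ∈ range j, rho p ^ k) • (y p ^ i * x p ^ (j - 1)) := by
  cases j with
  | zero => simp [pow_succ]
  | succ j =>
    rw [mul_assoc, x_pow_mul_y, mul_add, mul_smul_comm, mul_smul_comm, ← mul_assoc,
      ← pow_succ, Nat.add_sub_cancel]

theorem repr_x_commutator (p : ℕ) (i j : ℕ) :
    (monomialBasis p).repr (x p * (monomialBasis p (i, j)) - (monomialBasis p (i, j)) * x p) =
      (rho p ^ i - 1) • Finsupp.single (i, j + 1) 1 +
      (∑ k ∈ range i, rho p ^ k) • Finsupp.single (i - 1, j) 1 := by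
  rw [monomialBasis_apply, x_mul_monomial, mul_assoc, ← pow_succ,
    ← monomialBasis_apply p (i, j + 1), ← monomialBasis_apply p (i - 1, j)]
  simp only [map_sub, map_add, map_smul, Module.Basis.repr_self]
  module

theorem repr_commutator_y (p : ℕ) (i j : ℕ) :
    (monomialBasis p).repr ((monomialBasis p (i, j)) * y p - y p * (monomialBasis p (i, j))) =
      (rho p ^ j - 1) • Finsupp.single (i + 1, j) 1 +
      (∑ k ∈ range j, rho p ^ k) • Finsupp.single (i, j - 1) 1 := by
  rw [monomialBasis_apply, monomial_mul_y, ← mul_assoc, ← pow_succ',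
    ← monomialBasis_apply p (i + 1, j), ← monomialBasis_apply p (i, j - 1)]
  simp only [map_sub, map_add, map_smul, Module.Basis.repr_self]
  module

theorem repr_x_commutator_apply (p : ℕ) (z : B p) (i j : ℕ) :
    (monomialBasis p).repr (x p * z - z * x p) (i, j) =
      (rho p ^ i - 1) * (if j = 0 then 0 else (monomialBasis p).repr z (i, j - 1)) +
      (∑ k ∈ range (i + 1), rho p ^ k) * (monomialBasis p).repr z (i + 1, j) := by
  induction (monomialBasis p).mem_span z using Submodule.span_induction with
  | mem z hz =>
    obtain ⟨⟨k, l⟩, rfl⟩ := hz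
    rw [repr_x_commutator]
    simp only [Finsupp.add_apply, Finsupp.smul_apply, Module.Basis.repr_self, smul_eq_mul,
      Finsupp.single_apply, Prod.mk.injEq]
    congr 1
    · rcases j with _ | j
      · simp
      · by_cases h : k = i
        · subst h; simp
        · simp [h]
    · rcases k with _ | k
      · simp
      · by_cases h : k = i
        · subst h; simp
        · simp [h]
  | zero => simp
  | add z z' _ _ h h' =>
    rw [show x p * (z + z') - (z + z') * x p = (x p * z - z * x p) + (x p * z' - z' * x p) by
      noncomm_ring, map_add, Finsupp.add_apply, h, h', map_add, Finsupp.add_apply,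
      Finsupp.add_apply]
    split_ifs <;> ring
  | smul r z _ h =>
    rw [mul_smul_comm, smul_mul_assoc, ← smul_sub, map_smul, Finsupp.smul_apply, h, map_smul,
      Finsupp.smul_apply, Finsupp.smul_apply]
    simp only [smul_eq_mul]
    split_ifs <;> ring

theorem repr_commutator_y_apply (p : ℕ) (z : B p) (i j : ℕ) :
    (monomialBasis p).repr (z * y p - y p * z) (i, j) =
      (rho p ^ j - 1) * (if i = 0 then 0 else (monomialBasis p).repr z (i - 1, j)) +
      (∑ k ∈ range (j + 1), rho p ^ k) * (monomialBasis p).repr z (i, j + 1) := by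
  induction (monomialBasis p).mem_span z using Submodule.span_induction with
  | mem z hz =>
    obtain ⟨⟨k, l⟩, rfl⟩ := hz
    rw [repr_commutator_y]
    simp only [Finsupp.add_apply, Finsupp.smul_apply, Module.Basis.repr_self, smul_eq_mul,
      Finsupp.single_apply, Prod.mk.injEq]
    congr 1
    · rcases i with _ | i
      · simp
      · by_cases h : l = j
        · subst h; simp
        · simp [h]
    · rcases l with _ | l
      · simp
      · by_cases h : l = j
        · subst h; simp
        · simp [h]
  | zero => simp
  | add z z' _ _ h h' =>
    rw [show (z + z') * y p - y p * (z + z') = (z * y p - y p * z) + (z' * y p - y p * z') by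
      noncomm_ring, map_add, Finsupp.add_apply, h, h', map_add, Finsupp.add_apply,
      Finsupp.add_apply]
    split_ifs <;> ring
  | smul r z _ h =>
    rw [mul_smul_comm, smul_mul_assoc, ← smul_sub, map_smul, Finsupp.smul_apply, h, map_smul,
      Finsupp.smul_apply, Finsupp.smul_apply]
    simp only [smul_eq_mul]
    split_ifs <;> ring

theorem rho_pow_sub_one (p i : ℕ) :
    rho p ^ i - 1 = eta p * ∑ k ∈ range i, rho p ^ k :=
  (mul_geom_sum (rho p) i).symm

/-- Comparing coefficients in `x z = z x`, by induction on the exponent of `x`. -/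
theorem geom_sum_mul_repr_eq_zero_of_x (p : ℕ) {z : B p} (h : x p * z = z * x p) (j i : ℕ) :
    (∑ k ∈ range i, rho p ^ k) * (monomialBasis p).repr z (i, j) = 0 := by
  induction j generalizing i with
  | zero =>
    cases i with
    | zero => simp
    | succ i => simpa [h] using (repr_x_commutator_apply p z i 0).symm
  | succ j ih =>
    cases i with
    | zero => simp
    | succ i =>
      have e := (repr_x_commutator_apply p z i (j + 1)).symm
      rw [if_neg j.succ_ne_zero, Nat.add_sub_cancel, rho_pow_sub_one, mul_assoc, ih, mul_zero,
        zero_add, h, sub_self, map_zero, Finsupp.zero_apply] at e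
      exact e

/-- Comparing coefficients in `z y = y z`, by induction on the exponent of `y`. -/
theorem geom_sum_mul_repr_eq_zero_of_y (p : ℕ) {z : B p} (h : z * y p = y p * z) (i j : ℕ) :
    (∑ k ∈ range j, rho p ^ k) * (monomialBasis p).repr z (i, j) = 0 := by
  induction i generalizing j with
  | zero =>
    cases j with
    | zero => simp
    | succ j => simpa [h] using (repr_commutator_y_apply p z 0 j).symm
  | succ i ih =>
    cases j with
    | zero => simp
    | succ j =>
      have e := (repr_commutator_y_apply p z (i + 1) j).symm
      rw [if_neg i.succ_ne_zero, Nat.add_sub_cancel, rho_pow_sub_one, mul_assoc, ih, mul_zero,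
        zero_add, h, sub_self, map_zero, Finsupp.zero_apply] at e
      exact e

/-- Only monomials whose exponents are both divisible by `p` occur in a central element. -/
theorem dvd_of_repr_ne_zero (p : ℕ) (hp : p.Prime) (z : C p) {i j : ℕ}
    (h : (monomialBasis p).repr (z : B p) (i, j) ≠ 0) : p ∣ i ∧ p ∣ j := by
  have hz := Subalgebra.mem_center_iff.1 z.2
  refine ⟨?_, ?_⟩ <;> by_contra hd <;> refine h ?_ <;>
    rw [← (isUnit_geom_sum_rho_of_not_dvd p hp hd).mul_right_eq_zero]
  · exact geom_sum_mul_repr_eq_zero_of_x p (hz _) j i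
  · exact geom_sum_mul_repr_eq_zero_of_y p (hz _).symm i j

/-- The map `ℤ[ρ][S, T] → C` given by `S ↦ s` and `T ↦ t`. -/
noncomputable abbrev centerMap (p : ℕ) (hp : p.Prime) :
    MvPolynomial (Fin 2) (ZRho p) →ₐ[ZRho p] C p :=
  MvPolynomial.aeval ![s p hp, t p hp]

theorem centerMap_surjective (p : ℕ) (hp : p.Prime) : Function.Surjective (centerMap p hp) := by
  intro z
  suffices h : (z : B p) ∈ ((Subalgebra.center (ZRho p) (B p)).val.comp (centerMap p hp)).range by
    obtain ⟨f, hf⟩ := h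
    exact ⟨f, Subtype.ext hf⟩
  rw [← (monomialBasis p).linearCombination_repr (z : B p), Finsupp.linearCombination_apply]
  refine sum_mem fun ⟨i, j⟩ hij => Subalgebra.smul_mem _ ?_ _
  obtain ⟨⟨k, rfl⟩, l, rfl⟩ := dvd_of_repr_ne_zero p hp z (Finsupp.mem_support_iff.1 hij)
  refine ⟨MvPolynomial.X 1 ^ k * MvPolynomial.X 0 ^ l, ?_⟩
  simp [monomialBasis_apply, s, t, pow_mul]

/-- The `ℤ[ρ]`-linear map `B → ℤ[ρ][S, T]` that takes `y ^ (i + p k) x ^ (j + p l)`, for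
`i, j < p`, to `S ^ l T ^ k`, and every other monomial to `0`: the coordinate at `y ^ i x ^ j` over
the center. -/
noncomputable def centerCoord (p i j : ℕ) : B p →ₗ[ZRho p] MvPolynomial (Fin 2) (ZRho p) :=
  (monomialBasis p).constr (ZRho p) fun a =>
    if a.1 % p = i ∧ a.2 % p = j then
      MvPolynomial.X 0 ^ (a.2 / p) * MvPolynomial.X 1 ^ (a.1 / p) else 0

theorem centerCoord_monomial (p i j a b : ℕ) : centerCoord p i j (y p ^ a * x p ^ b) =
    if a % p = i ∧ b % p = j then
      MvPolynomial.X 0 ^ (b / p) * MvPolynomial.X 1 ^ (a / p) else 0 := by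
  rw [← monomialBasis_apply p (a, b), centerCoord, Module.Basis.constr_basis]

theorem centerCoord_s_mul (p : ℕ) (hp : p.Prime) (i j : ℕ) (b : B p) :
    centerCoord p i j (s p hp * b) = MvPolynomial.X 0 * centerCoord p i j b := by
  suffices h : (centerCoord p i j) ∘ₗ LinearMap.mulLeft (ZRho p) (s p hp : B p) =
      LinearMap.mulLeft (ZRho p) (MvPolynomial.X 0) ∘ₗ centerCoord p i j from
    LinearMap.congr_fun h b
  refine (monomialBasis p).ext fun ⟨a, c⟩ => ?_
  have hc : (s p hp : B p) * y p ^ a = y p ^ a * x p ^ p :=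
    (Subalgebra.mem_center_iff.1 (s p hp).2 _).symm
  simp only [LinearMap.comp_apply, LinearMap.mulLeft_apply, monomialBasis_apply]
  rw [← mul_assoc, hc, mul_assoc, ← pow_add, centerCoord_monomial, centerCoord_monomial,
    Nat.add_mod_left, Nat.add_div_left _ hp.pos, mul_ite, mul_zero, pow_succ', mul_assoc]

theorem centerCoord_t_mul (p : ℕ) (hp : p.Prime) (i j : ℕ) (b : B p) :
    centerCoord p i j (t p hp * b) = MvPolynomial.X 1 * centerCoord p i j b := by
  suffices h : (centerCoord p i j) ∘ₗ LinearMap.mulLeft (ZRho p) (t p hp : B p) =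
      LinearMap.mulLeft (ZRho p) (MvPolynomial.X 1) ∘ₗ centerCoord p i j from
    LinearMap.congr_fun h b
  refine (monomialBasis p).ext fun ⟨a, c⟩ => ?_
  simp only [LinearMap.comp_apply, LinearMap.mulLeft_apply, monomialBasis_apply]
  rw [← mul_assoc, show (t p hp : B p) = y p ^ p from rfl, ← pow_add, centerCoord_monomial,
    centerCoord_monomial, Nat.add_mod_left, Nat.add_div_left _ hp.pos, mul_ite, mul_zero, pow_succ',
    mul_left_comm]

/-- The coordinate maps are linear over `ℤ[ρ][S, T]`, acting on `B` through `s` and `t`. -/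
theorem centerCoord_centerMap_mul (p : ℕ) (hp : p.Prime) (i j : ℕ)
    (f : MvPolynomial (Fin 2) (ZRho p)) (b : B p) :
    centerCoord p i j (centerMap p hp f * b) = f * centerCoord p i j b := by
  induction f using MvPolynomial.induction_on generalizing b with
  | C r =>
    rw [MvPolynomial.aeval_C, Subalgebra.coe_algebraMap, ← Algebra.smul_def, map_smul,
      MvPolynomial.C_mul']
  | add f g hf hg => rw [map_add, Subalgebra.coe_add, add_mul, map_add, hf, hg, add_mul]
  | mul_X f n hf =>
    rw [map_mul (centerMap p hp), Subalgebra.coe_mul, mul_assoc, hf, MvPolynomial.aeval_X, mul_assoc]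
    congr 1
    fin_cases n
    · exact centerCoord_s_mul p hp i j b
    · exact centerCoord_t_mul p hp i j b

theorem centerMap_bijective (p : ℕ) (hp : p.Prime) : Function.Bijective (centerMap p hp) := by
  have h : centerCoord p 0 0 1 = 1 := by simpa using centerCoord_monomial p 0 0 0 0
  have hl : Function.LeftInverse (fun z : C p => centerCoord p 0 0 z) (centerMap p hp) := by
    intro f
    have := centerCoord_centerMap_mul p hp 0 0 f 1
    rwa [mul_one, h, mul_one] at this
  exact ⟨hl.injective, centerMap_surjective p hp⟩

/-! ### The basis of `B` over its center -/

instance (p : ℕ) : IsScalarTower (ZRho p) (C p) (B p) :=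
  ⟨fun r c b => smul_mul_assoc r (c : B p) b⟩

theorem center_smul_def (p : ℕ) (c : C p) (b : B p) : c • b = (c : B p) * b := rfl

/-- The `C`-linear coordinate of an element of `B` at `y ^ i x ^ j`. -/
noncomputable def centerDual (p : ℕ) (hp : p.Prime) (i : Fin p × Fin p) :
    Module.Dual (C p) (B p) where
  toFun b := centerMap p hp (centerCoord p i.1 i.2 b)
  map_add' a b := by simp
  map_smul' c b := by
    obtain ⟨f, rfl⟩ := centerMap_surjective p hp c
    rw [center_smul_def, centerCoord_centerMap_mul, map_mul]; rfl

theorem centerDual_monomial (p : ℕ) (hp : p.Prime) (i j : Fin p × Fin p) :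
    centerDual p hp i (y p ^ (j.1 : ℕ) * x p ^ (j.2 : ℕ)) = if i = j then 1 else 0 := by
  change centerMap p hp (centerCoord p i.1 i.2 _) = _
  rw [centerCoord_monomial, Nat.mod_eq_of_lt j.1.2, Nat.mod_eq_of_lt j.2.2,
    Nat.div_eq_of_lt j.1.2, Nat.div_eq_of_lt j.2.2]
  have : ((j.1 : ℕ) = i.1 ∧ (j.2 : ℕ) = i.2) ↔ i = j := by
    rw [Prod.ext_iff, Fin.ext_iff, Fin.ext_iff, eq_comm, @eq_comm _ (j.2 : ℕ)]
  rw [if_congr this rfl rfl]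
  split_ifs <;> simp

/-- The `p ^ 2` monomials `y ^ i x ^ j` with `i, j < p` form a basis of `B` over its center. -/
noncomputable def centerBasis (p : ℕ) (hp : p.Prime) :
    Module.Basis (Fin p × Fin p) (C p) (B p) :=
  .mk (v := fun j => y p ^ (j.1 : ℕ) * x p ^ (j.2 : ℕ))
    (LinearIndependent.of_pairwise_dual_eq_zero_one _ (centerDual p hp)
      (fun i j h => (centerDual_monomial p hp i j).trans (if_neg h))
      (fun i => (centerDual_monomial p hp i i).trans (if_pos rfl)))
    (fun b _ => by
      induction (monomialBasis p).mem_span b using Submodule.span_induction with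
      | mem b hb =>
        obtain ⟨⟨k, l⟩, rfl⟩ := hb
        have e : monomialBasis p (k, l) = (t p hp ^ (k / p) * s p hp ^ (l / p)) •
            (y p ^ (k % p) * x p ^ (l % p)) := by
          have hc : ((s p hp : B p) ^ (l / p)) * y p ^ (k % p) =
              y p ^ (k % p) * (x p ^ p) ^ (l / p) :=
            (Subalgebra.mem_center_iff.1 (s p hp ^ (l / p)).2 _).symm
          rw [center_smul_def, Subalgebra.coe_mul, Subalgebra.coe_pow, Subalgebra.coe_pow,
            mul_assoc, ← mul_assoc _ (y p ^ (k % p)), hc, mul_assoc, ← mul_assoc,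
            show (t p hp : B p) = y p ^ p from rfl, ← pow_mul, ← pow_mul, ← pow_add, ← pow_add,
            Nat.div_add_mod, Nat.div_add_mod, monomialBasis_apply]
        rw [e]
        exact Submodule.smul_mem _ _ (Submodule.subset_span
          ⟨(⟨k % p, Nat.mod_lt _ hp.pos⟩, ⟨l % p, Nat.mod_lt _ hp.pos⟩), rfl⟩)
      | zero => exact zero_mem _
      | add b b' _ _ h h' => exact add_mem (h trivial) (h' trivial)
      | smul r b _ h =>
        rw [← algebraMap_smul (C p) r b]
        exact Submodule.smul_mem _ _ (h trivial))

theorem centerBasis_apply (p : ℕ) (hp : p.Prime) (i : Fin p × Fin p) :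
    centerBasis p hp i = y p ^ (i.1 : ℕ) * x p ^ (i.2 : ℕ) := by
  simp [centerBasis]

/-! ### The Azumaya locus -/

/-- The `p`-th power of the commutator `x y - y x` is the element `π` of the center. -/
theorem commutator_pow (p : ℕ) (hp : p.Prime) : (x p * y p - y p * x p) ^ p = disc p hp := by
  have h := QWeyl.aeval_commutator_prod (x_mul_y p) p
  rw [prod_rho_pow_mul_X_sub_one p hp] at h
  simp only [map_mul, map_pow, map_neg, map_one, map_sub, Polynomial.aeval_X] at h
  have hd : (disc p hp : B p) = 1 - (-1) ^ p * (eta p ^ p • (x p ^ p * y p ^ p)) := by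
    change 1 + (-1) ^ (p + 1) * (x p ^ p * y p ^ p * algebraMap (ZRho p) (B p) (eta p) ^ p) = _
    rw [← map_pow, ← Algebra.commutes, ← Algebra.smul_def, pow_succ, mul_neg_one, neg_mul,
      ← sub_eq_add_neg]
  rw [hd, ← h, ← mul_assoc, ← pow_add, Even.neg_one_pow ⟨p, rfl⟩, one_mul, sub_sub_cancel]

/-- Over any commutative `C`-algebra, the base change of `B` is Azumaya exactly when `π` becomes
invertible. -/
theorem isAzumaya_baseChange_iff (p : ℕ) (hp : p.Prime) (K : Type*) [CommRing K] [Algebra (C p) K] :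
    IsAzumaya K (K ⊗[C p] B p) ↔ IsUnit (algebraMap (C p) K (disc p hp)) := by
  let φ : B p →ₐ[C p] K ⊗[C p] B p := Algebra.TensorProduct.includeRight
  let r : ZRho p →+* K := (algebraMap (C p) K).comp (algebraMap (ZRho p) (C p))
  have hφ (c : C p) : φ (c : B p) = algebraMap K _ (algebraMap (C p) K c) := by
    rw [← IsScalarTower.algebraMap_apply]
    exact φ.commutes c
  have hr (q : ZRho p) (b : B p) : φ (q • b) = r q • φ b := by
    rw [← algebraMap_smul (C p) q b, map_smul, ← algebraMap_smul K]
    rfl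
  have hrel : φ (x p) * φ (y p) = r (rho p) • (φ (y p) * φ (x p)) + 1 := by
    rw [← map_mul, x_mul_y, map_add, hr, map_mul, map_one]
  refine QWeyl.isAzumaya_iff (s := algebraMap (C p) K (s p hp)) (t := algebraMap (C p) K (t p hp))
    hrel ((isUnit_rho p hp).map r) hp.one_lt (fun n h0 hn => ?_)
    ((centerBasis p hp).baseChange K) (fun i => ?_) ?_ ?_ ?_
  · simpa using (isUnit_geom_sum_rho p hp n h0 hn).map r
  · rw [Module.Basis.baseChange_apply, centerBasis_apply, ← map_pow, ← map_pow, ← map_mul]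
    rfl
  · rw [← map_pow, ← hφ]; rfl
  · rw [← map_pow, ← hφ]; rfl
  · rw [← map_mul, ← map_mul, ← map_sub, ← map_pow, commutator_pow p hp, hφ]

end CuriousAlgebra

/-- The center `C` of `B` is the polynomial ring `ℤ[ρ][s, t]`; the points of `Spec C` at which `B`
is Azumaya are exactly those of the basic open set `D(1 + (-1) ^ (p + 1) s t η ^ p)`, which is
`D(1 + s t η ^ p)` for odd `p`; and `B` is Azumaya over that open set as a whole. -/
theorem theorem3p3 (p : ℕ) (hp : p.Prime) :
    Function.Bijective
      (MvPolynomial.aeval ![CuriousAlgebra.s p hp, CuriousAlgebra.t p hp] :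
        MvPolynomial (Fin 2) (CuriousAlgebra.ZRho p) →ₐ[CuriousAlgebra.ZRho p]
          CuriousAlgebra.C p) ∧
    CuriousAlgebra.azumayaLocus (CuriousAlgebra.C p) (CuriousAlgebra.B p) =
      (PrimeSpectrum.basicOpen (CuriousAlgebra.disc p hp) :
        Set (PrimeSpectrum (CuriousAlgebra.C p))) ∧
    IsAzumaya (Localization.Away (CuriousAlgebra.disc p hp))
      (Localization.Away (CuriousAlgebra.disc p hp) ⊗[CuriousAlgebra.C p] CuriousAlgebra.B p) := by
  refine ⟨CuriousAlgebra.centerMap_bijective p hp, ?_, ?_⟩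
  · ext P
    simp only [CuriousAlgebra.azumayaLocus, Set.mem_ofPred_eq, SetLike.mem_coe,
      PrimeSpectrum.mem_basicOpen]
    rw [CuriousAlgebra.isAzumaya_baseChange_iff p hp,
      IsLocalization.AtPrime.isUnit_to_map_iff _ P.asIdeal]
    rfl
  · rw [CuriousAlgebra.isAzumaya_baseChange_iff p hp]
    exact IsLocalization.Away.algebraMap_isUnit _
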